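/- **Proposition (Hadwiger).** Let $P\subset\mathbb{R}^3$ be a $3$-polytope, i.e. the convex hull of finitely many points with nonempty interior, let $V(P)$ be its volume and $S(P)$ its surface area. Suppose that the boundary of $P$ has a triangulation (a finite geometric simplicial complex whose underlying space is the boundary of $P$; its vertices need not all be vertices of $P$) that is combinatorially equivalent to the boundary complex of the octahedron. Then $$\frac{S(P)^3}{V(P)^2}\ \ge\ 108\sqrt{3},$$ with equality if and only if $P$ is a regular octahedron. -/

import Mathlib

/-- Euclidean 3-space. -/
abbrev E3 : Type := EuclideanSpace ℝ (Fin 3)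

/-- A 3-polytope in Euclidean 3-space: the convex hull of finitely many points, with nonempty
interior. -/
def IsThreePolytope (P : Set E3) : Prop :=
  (∃ X : Finset E3, P = convexHull ℝ (X : Set E3)) ∧ (interior P).Nonempty

/-- The volume `V(P)`. -/
noncomputable def vol (P : Set E3) : ℝ :=
  (MeasureTheory.volume P).toReal

/-- The surface area `S(P)`: the two-dimensional Hausdorff measure of the boundary, normalized so
that it is Lebesgue measure (ordinary area) on planes. -/
noncomputable def surfaceArea (P : Set E3) : ℝ :=
  (MeasureTheory.Measure.euclideanHausdorffMeasure 2 (frontier P)).toReal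

/-- A triangulation of the surface of `P`: a finite geometric simplicial complex whose underlying
space is the boundary of `P`. -/
def IsSurfaceTriangulation (K : Geometry.SimplicialComplex ℝ E3) (P : Set E3) : Prop :=
  K.faces.Finite ∧ K.space = frontier P

/-- The vertices of an abstract simplicial complex whose ground type may contain further points. -/
abbrev VertexType {α : Type*} (K : PreAbstractSimplicialComplex α) : Type _ :=
  {v : α // {v} ∈ K.faces}

/-- Two simplicial complexes have the same combinatorial type: there is a bijection between their
vertices under which faces correspond to faces, in both directions. -/
def SameCombinatorialType {α β : Type*} (K : PreAbstractSimplicialComplex α)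
    (L : PreAbstractSimplicialComplex β) : Prop :=
  ∃ e : VertexType K ≃ VertexType L, ∀ s : Finset (VertexType K),
    s.map (Function.Embedding.subtype _) ∈ K.faces ↔
      (s.map e.toEmbedding).map (Function.Embedding.subtype _) ∈ L.faces

/-- The boundary complex of the octahedron. The vertices are `(i, true)` and `(i, false)`, for the
two ends of the `i`-th of the three diagonals; a nonempty set of vertices is a face exactly if it
does not contain both ends of a diagonal. -/
def octahedronComplex : PreAbstractSimplicialComplex (Fin 3 × Bool) where
  faces := {s | s.Nonempty ∧ ∀ i : Fin 3, ¬((i, true) ∈ s ∧ (i, false) ∈ s)}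
  isRelLowerSet_faces := fun _ hs =>
    ⟨hs.1, fun _ hts ht => ⟨ht, fun i hi => hs.2 i ⟨hts hi.1, hts hi.2⟩⟩⟩

/-- A regular octahedron: the convex hull of the six points `c ± r • uᵢ` for some center `c`, some
`r > 0` and some orthonormal basis `u₁, u₂, u₃`. -/
def IsRegularOctahedron (P : Set E3) : Prop :=
  ∃ (c : E3) (r : ℝ) (u : OrthonormalBasis (Fin 3) ℝ E3), 0 < r ∧
    P = convexHull ℝ (Set.range (fun i => c + r • u i) ∪ Set.range (fun i => c - r • u i))

/-!
Let `x i b` (`i : Fin 3`, `b : Bool`) be the six vertices of the triangulation, so that the faces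
are the triangles with corners `x i (ε i)`, `ε : Fin 3 → Bool`, and let
`d i = x i true - x i false` be the three diagonals. Put `D = det (d 0, d 1, d 2)`. The theorem
follows from three facts.

*Volume.* The cones from an interior point `o` over the faces cover `P`, so `V ≤ ∑ |det_ε| / 6`,
where `det_ε` is the determinant of the corners of the face `ε` relative to `o`. Cones over
adjacent faces cannot overlap, since a ray from `o` meets the boundary only once; hence the two
determinants have opposite signs (`det3_mul_det3_neg_of_adjacent`). So all the numbers `± det_ε`,
with the sign of the face as an orientation, agree in sign, and `∑ |det_ε| = |∑ ± det_ε| = |D|` by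
multilinearity. Hence `V ≤ |D| / 6` (`IsOctahedralSurface.vol_le`).

*Area.* Faces meet in sets of area zero, so `S = ∑ ‖A_ε‖`, where `A_ε` is the area vector of the
face (`IsOctahedralSurface.surfaceArea_eq`). For an orthonormal basis `e` put `n_ε = ∑ ± e i`, the
normals of a regular octahedron, with `‖n_ε‖ = √3`. By Cauchy-Schwarz `√3 S ≥ ∑ ⟪± A_ε, n_ε⟫`, and
by multilinearity the right-hand side is `⟪e 0, d 1 × d 2⟫ + ⟪e 1, d 2 × d 0⟫ + ⟪e 2, d 0 × d 1⟫`
(`sum_inner_areaVector`). A Gram-Schmidt choice of `e` makes these three terms positive with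
product `D²` (`exists_orthonormal_frame`), and the inequality of arithmetic and geometric means
gives `(√3 S)³ ≥ 27 D² ≥ 27 · 36 V²`, which is the claim.

*Equality.* If equality holds, every `A_ε` is parallel to `n_ε`, so every edge of the face `ε` is
orthogonal to `n_ε`; this forces `x i b = c ± r e i` (`exists_regular_of_edges_orthogonal`).
Conversely, for the regular octahedron, which is a ball of the taxicab distance, `S ≤ 4 √3 r²` and
`V = 4 r³ / 3`, so that the inequality is attained.
-/

open MeasureTheory Set Module
open scoped InnerProductSpace

/-! ### Hausdorff measure of a simplex -/

theorem mem_convexHull_range_iff {ι E : Type*} [Fintype ι] [AddCommGroup E] [Module ℝ E]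
    {x : ι → E} {y : E} :
    y ∈ convexHull ℝ (range x) ↔ ∃ w : ι → ℝ, (∀ i, 0 ≤ w i) ∧ ∑ i, w i = 1 ∧
      ∑ i, w i • x i = y := by
  classical
  have h : convexHull ℝ (range x) = Fintype.linearCombination ℝ x '' stdSimplex ℝ ι := by
    rw [← convexHull_rangle_single_eq_stdSimplex ℝ ι, LinearMap.image_convexHull, ← range_comp]
    congr 2
    ext i
    simp [Fintype.linearCombination_apply]
  rw [h]
  simp only [mem_image, stdSimplex, mem_ofPred_eq, Fintype.linearCombination_apply, and_assoc]

/-- By slicing along the first coordinate and induction on the dimension. -/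
theorem volume_pi_cornerSimplex (n : ℕ) {r : ℝ} (hr : 0 ≤ r) :
    volume {x : Fin n → ℝ | (∀ i, 0 ≤ x i) ∧ ∑ i, x i ≤ r} =
      ENNReal.ofReal (r ^ n / n.factorial) := by
  induction n generalizing r with
  | zero => simp [hr, volume_pi]
  | succ n ih =>
    have hcl : IsClosed {x : Fin (n + 1) → ℝ | (∀ i, 0 ≤ x i) ∧ ∑ i, x i ≤ r} := by
      simp only [ofPred_and, ofPred_forall]
      exact (isClosed_iInter fun i => isClosed_le continuous_const (continuous_apply i)).inter
        (isClosed_le (by fun_prop) continuous_const)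
    rw [← (volume_preserving_piFinSuccAbove (fun _ : Fin (n + 1) => ℝ) 0).symm.measure_preimage
      hcl.measurableSet.nullMeasurableSet, Measure.volume_eq_prod,
      Measure.prod_apply ((MeasurableEquiv.measurable _) hcl.measurableSet)]
    have hslice : ∀ t : ℝ, volume (Prod.mk t ⁻¹'
        ((MeasurableEquiv.piFinSuccAbove (fun _ : Fin (n + 1) => ℝ) 0).symm ⁻¹'
          {x : Fin (n + 1) → ℝ | (∀ i, 0 ≤ x i) ∧ ∑ i, x i ≤ r})) =
        (Icc 0 r).indicator (fun t => ENNReal.ofReal ((r - t) ^ n / n.factorial)) t := by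
      intro t
      by_cases ht : t ∈ Icc 0 r
      · rw [indicator_of_mem ht, ← ih (sub_nonneg.2 ht.2)]
        congr 1
        ext y
        simp [MeasurableEquiv.piFinSuccAbove, Fin.forall_fin_succ, Fin.sum_univ_succ, ht.1,
          le_sub_iff_add_le']
      · rw [indicator_of_notMem ht]
        convert measure_empty (μ := (volume : Measure (Fin n → ℝ)))
        ext y
        simp only [MeasurableEquiv.piFinSuccAbove, mem_preimage, mem_ofPred_eq, mem_empty_iff_false,
          iff_false]
        rintro ⟨h0, h1⟩
        simp [Fin.forall_fin_succ, Fin.sum_univ_succ] at h0 h1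
        have := Finset.sum_nonneg fun i (_ : i ∈ Finset.univ) => h0.2 i
        exact ht ⟨h0.1, by linarith⟩
    simp_rw [hslice]
    rw [lintegral_indicator measurableSet_Icc, ← ofReal_integral_eq_lintegral_ofReal]
    · congr 1
      rw [integral_Icc_eq_integral_Ioc, ← intervalIntegral.integral_of_le hr,
        intervalIntegral.integral_comp_sub_left (fun x => x ^ n / (n.factorial : ℝ)) r]
      simp only [sub_self, sub_zero, intervalIntegral.integral_div, integral_pow]
      rw [Nat.factorial_succ]
      push_cast
      field_simp
      simp
    · exact (Continuous.integrableOn_Icc (by fun_prop))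
    · refine (ae_restrict_iff' measurableSet_Icc).2 (Filter.Eventually.of_forall fun t ht => ?_)
      have := sub_nonneg.2 ht.2
      positivity

/-- The `n`-dimensional area of an `n`-simplex in a space of any dimension. The simplex is the
image of the corner simplex under an affine map whose linear part has the Gram determinant of the
edge vectors at `x 0` as its squared volume factor; degenerate simplices are included. -/
theorem euclideanHausdorffMeasure_convexHull_range {V : Type*} [NormedAddCommGroup V]
    [InnerProductSpace ℝ V] [MeasurableSpace V] [BorelSpace V] {n : ℕ} (x : Fin (n + 1) → V) :
    Measure.euclideanHausdorffMeasure n (convexHull ℝ (range x)) =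
      ENNReal.ofReal
        (√(Matrix.gram ℝ fun i : Fin n => x i.succ - x 0).det / n.factorial) := by
  let b := EuclideanSpace.basisFun (Fin n) ℝ
  let f : EuclideanSpace ℝ (Fin n) →ₗ[ℝ] V := b.toBasis.constr ℝ fun i => x i.succ - x 0
  have hf : ∀ i, f (b i) = x i.succ - x 0 := fun i => by
    rw [← b.coe_toBasis, Basis.constr_basis]
  have hfx : ∀ w, f w = ∑ i, w i • (x i.succ - x 0) := fun w => by
    rw [Basis.constr_apply_fintype]; simp [b]
  let C : Set (EuclideanSpace ℝ (Fin n)) := {w | (∀ i, 0 ≤ w i) ∧ ∑ i, w i ≤ 1}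
  have hC : volume C = ENNReal.ofReal (1 / n.factorial) := by
    have := volume_pi_cornerSimplex n zero_le_one
    rw [one_pow] at this
    rw [← this, ← MeasurePreserving.measure_preimage_equiv
      (f := MeasurableEquiv.toLp 2 (Fin n → ℝ)) (PiLp.volume_preserving_toLp (Fin n))]
    rfl
  have himg : convexHull ℝ (range x) = (fun v => x 0 + v) '' (f '' C) := by
    ext y
    rw [mem_convexHull_range_iff, image_image, mem_image]
    constructor
    · rintro ⟨w, hw, hw1, rfl⟩
      rw [Fin.sum_univ_succ] at hw1
      refine ⟨WithLp.toLp 2 fun i => w i.succ, ⟨fun i => hw _, ?_⟩, ?_⟩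
      · have := hw 0
        simp only; linarith
      · rw [hfx, Fin.sum_univ_succ, ← eq_sub_iff_add_eq] at *
        simp only [smul_sub, Finset.sum_sub_distrib, ← Finset.sum_smul]
        rw [hw1]
        module
    · rintro ⟨w, ⟨hw, hw1⟩, rfl⟩
      refine ⟨Fin.cons (1 - ∑ i, w i) w, ?_, ?_, ?_⟩
      · intro i
        refine Fin.cases ?_ ?_ i
        · simpa using hw1
        · simpa using hw
      · simp [Fin.sum_univ_succ]
      · simp only [Fin.sum_univ_succ, Fin.cons_zero, Fin.cons_succ, hfx, smul_sub,
          Finset.sum_sub_distrib, ← Finset.sum_smul]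
        module
  rw [himg, (isometry_add_left (x 0)).euclideanHausdorffMeasure_image]
  have h := f.euclideanHausdorffMeasure_image_eq_normDet_mul_volume C
  rw [finrank_euclideanSpace_fin, hC, ← ENNReal.ofReal_mul f.normDet_nonneg] at h
  rw [h]
  congr 1
  have h2 := f.normDet_sq_eq_det_gram b
  simp only [hf] at h2
  rw [← h2]
  simp [Real.sqrt_sq f.normDet_nonneg, div_eq_mul_inv]

/-! ### Cross products, area vectors and octahedral sums -/

/-- The cross product of Euclidean 3-space. -/
noncomputable def cross (u v : E3) : E3 :=
  !₂[u 1 * v 2 - u 2 * v 1, u 2 * v 0 - u 0 * v 2, u 0 * v 1 - u 1 * v 0]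

/-- The determinant of three vectors of Euclidean 3-space, as a triple product. -/
noncomputable def det3 (u v w : E3) : ℝ := ⟪u, cross v w⟫_ℝ

theorem inner_eq_coord (u v : E3) : ⟪u, v⟫_ℝ = u 0 * v 0 + u 1 * v 1 + u 2 * v 2 := by
  simp [PiLp.inner_apply, Fin.sum_univ_three, mul_comm]

@[simp] theorem cross_apply_zero (u v : E3) : cross u v 0 = u 1 * v 2 - u 2 * v 1 := rfl
@[simp] theorem cross_apply_one (u v : E3) : cross u v 1 = u 2 * v 0 - u 0 * v 2 := rfl
@[simp] theorem cross_apply_two (u v : E3) : cross u v 2 = u 0 * v 1 - u 1 * v 0 := rfl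

theorem det3_eq (u v w : E3) : det3 u v w = u 0 * (v 1 * w 2 - v 2 * w 1) +
    u 1 * (v 2 * w 0 - v 0 * w 2) + u 2 * (v 0 * w 1 - v 1 * w 0) := by
  simp [det3, inner_eq_coord]

theorem inner_cross_self_left (u v : E3) : ⟪u, cross u v⟫_ℝ = 0 := by
  simp [inner_eq_coord]; ring

theorem inner_cross_self_right (u v : E3) : ⟪v, cross u v⟫_ℝ = 0 := by
  simp [inner_eq_coord]; ring

theorem inner_cross_cross (u v w z : E3) :
    ⟪cross u v, cross w z⟫_ℝ = ⟪u, w⟫_ℝ * ⟪v, z⟫_ℝ - ⟪u, z⟫_ℝ * ⟪v, w⟫_ℝ := by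
  simp [inner_eq_coord]; ring

theorem norm_cross_sq (u v : E3) :
    ‖cross u v‖ ^ 2 = ‖u‖ ^ 2 * ‖v‖ ^ 2 - ⟪u, v⟫_ℝ ^ 2 := by
  rw [← real_inner_self_eq_norm_sq, ← real_inner_self_eq_norm_sq, ← real_inner_self_eq_norm_sq,
    inner_cross_cross, real_inner_comm v u]; ring

/-- The area vector of the triangle with corners `T 0`, `T 1`, `T 2`: it is normal to the
triangle, its length is the area, and its direction is given by the order of the corners. -/
noncomputable def areaVector (T : Fin 3 → E3) : E3 := (1 / 2 : ℝ) • cross (T 1 - T 0) (T 2 - T 0)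

theorem euclideanHausdorffMeasure_triangle (T : Fin 3 → E3) :
    Measure.euclideanHausdorffMeasure 2 (convexHull ℝ (range T)) =
      ENNReal.ofReal ‖areaVector T‖ := by
  rw [euclideanHausdorffMeasure_convexHull_range]
  congr 1
  have : (Matrix.gram ℝ fun i : Fin 2 => T i.succ - T 0).det =
      ‖cross (T 1 - T 0) (T 2 - T 0)‖ ^ 2 := by
    rw [← real_inner_self_eq_norm_sq, inner_cross_cross, Matrix.det_fin_two]
    rfl
  rw [this, Real.sqrt_sq (norm_nonneg _), areaVector, norm_smul]
  norm_num
  ring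

theorem volume_tetrahedron (o : E3) (T : Fin 3 → E3) :
    volume (convexHull ℝ (range (Fin.cons o T : Fin 4 → E3))) =
      ENNReal.ofReal (|det3 (T 0 - o) (T 1 - o) (T 2 - o)| / 6) := by
  rw [← EuclideanSpace.euclideanHausdorffMeasure_eq_volume,
    euclideanHausdorffMeasure_convexHull_range]
  congr 1
  have : (Matrix.gram ℝ fun i : Fin 3 => (Fin.cons o T : Fin 4 → E3) i.succ -
      (Fin.cons o T : Fin 4 → E3) 0).det = det3 (T 0 - o) (T 1 - o) (T 2 - o) ^ 2 := by
    simp only [Matrix.det_fin_three, Matrix.gram_apply, Fin.cons_succ, Fin.cons_zero,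
      inner_eq_coord, det3_eq]
    ring
  rw [this, Real.sqrt_sq_eq_abs]
  norm_num [Nat.factorial]

/-! ### Signs indexed by the faces -/

/-- The sign of an end of a diagonal: `1` for `true` and `-1` for `false`. -/
def sgn (b : Bool) : ℝ := if b then 1 else -1

@[simp] theorem sgn_true : sgn true = 1 := rfl
@[simp] theorem sgn_false : sgn false = -1 := rfl

theorem sgn_mul_self (b : Bool) : sgn b * sgn b = 1 := by cases b <;> simp

theorem abs_sgn (b : Bool) : |sgn b| = 1 := by cases b <;> simp

/-- The orientation sign of the face `ε`: the area vectors of the faces of an octahedron, with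
corners ordered by their diagonals, all point outwards (or all inwards) after multiplication by
this sign. -/
noncomputable def signProd (ε : Fin 3 → Bool) : ℝ := sgn (ε 0) * sgn (ε 1) * sgn (ε 2)

theorem abs_signProd (ε : Fin 3 → Bool) : |signProd ε| = 1 := by
  simp [signProd, abs_mul, abs_sgn]

theorem sum_bool_cube {M : Type*} [AddCommMonoid M] (f : (Fin 3 → Bool) → M) :
    ∑ ε, f ε = ∑ a, ∑ b, ∑ c, f ![a, b, c] := by
  rw [← (Fin.consEquiv fun _ => Bool).sum_comp, Fintype.sum_prod_type]
  refine Finset.sum_congr rfl fun a _ => ?_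
  rw [← (Fin.consEquiv fun _ => Bool).sum_comp, Fintype.sum_prod_type]
  refine Finset.sum_congr rfl fun b _ => ?_
  rw [← (Fin.consEquiv fun _ => Bool).sum_comp, Fintype.sum_prod_type]
  refine Finset.sum_congr rfl fun c _ => ?_
  simp only [Finset.univ_unique, Finset.sum_singleton]
  congr 1

/-- The corners of the face `ε` of the octahedral surface with vertices `x i b`. -/
def corners (x : Fin 3 → Bool → E3) (ε : Fin 3 → Bool) : Fin 3 → E3 := fun i => x i (ε i)

/-- The vector along the `i`-th diagonal. -/
def diagonalVector (x : Fin 3 → Bool → E3) (i : Fin 3) : E3 := x i true - x i false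

/-- The signed sum over the faces is alternating in the two ends of each diagonal, so by
multilinearity only the diagonal vectors remain, and `o` cancels. -/
theorem sum_signProd_mul_det3 (x : Fin 3 → Bool → E3) (o : E3) :
    ∑ ε, signProd ε * det3 (x 0 (ε 0) - o) (x 1 (ε 1) - o) (x 2 (ε 2) - o) =
      det3 (diagonalVector x 0) (diagonalVector x 1) (diagonalVector x 2) := by
  rw [sum_bool_cube]
  simp [signProd, det3_eq, diagonalVector]
  ring

/-- In the sum of `sgn (ε 0) * signProd ε` times the area vector only the terms `x 1 _ × x 2 _` of
the area vector survive, and they add up to the cross product of two diagonals; likewise for the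
other two axes. -/
theorem sum_inner_areaVector (x : Fin 3 → Bool → E3) (e : Fin 3 → E3) :
    ∑ ε, ⟪signProd ε • areaVector (corners x ε), ∑ i, sgn (ε i) • e i⟫_ℝ =
      ⟪e 0, cross (diagonalVector x 1) (diagonalVector x 2)⟫_ℝ +
      ⟪e 1, cross (diagonalVector x 2) (diagonalVector x 0)⟫_ℝ +
      ⟪e 2, cross (diagonalVector x 0) (diagonalVector x 1)⟫_ℝ := by
  rw [sum_bool_cube]
  simp [signProd, diagonalVector, areaVector, corners, inner_eq_coord, Fin.sum_univ_three]
  ring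

theorem inner_areaVector_sub (T : Fin 3 → E3) (o : E3) :
    2 * ⟪areaVector T, T 0 - o⟫_ℝ = det3 (T 0 - o) (T 1 - o) (T 2 - o) := by
  simp [det3_eq, areaVector, inner_eq_coord]
  ring

theorem inner_areaVector_edge (T : Fin 3 → E3) (i j : Fin 3) :
    ⟪areaVector T, T i - T j⟫_ℝ = 0 := by
  have h : ∀ i, ⟪areaVector T, T i - T 0⟫_ℝ = 0 := by
    intro i
    fin_cases i <;> simp [areaVector, inner_eq_coord] <;> ring
  rw [← sub_sub_sub_cancel_right (T i) (T j) (T 0), inner_sub_right, h, h, sub_zero]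

/-- The frame is the Gram-Schmidt basis of the three cross products: up to signs, `e 0` is along
`d 1 × d 2`, `e 2` along `d 2`, and `e 1` along `d 2 × (d 1 × d 2)`, with signs that make the
three inner products positive. -/
theorem exists_orthonormal_frame (d : Fin 3 → E3) (hD : det3 (d 0) (d 1) (d 2) ≠ 0) :
    ∃ (e : Fin 3 → E3) (t : Fin 3 → ℝ), Orthonormal ℝ e ∧ (∀ i, 0 < t i) ∧
      t 0 * t 1 * t 2 = det3 (d 0) (d 1) (d 2) ^ 2 ∧
      ⟪e 0, cross (d 1) (d 2)⟫_ℝ = t 0 ∧ ⟪e 1, cross (d 2) (d 0)⟫_ℝ = t 1 ∧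
      ⟪e 2, cross (d 0) (d 1)⟫_ℝ = t 2 := by
  set D := det3 (d 0) (d 1) (d 2) with hDdef
  -- `s` is the sign of the determinant.
  obtain ⟨s, hs, hsD⟩ : ∃ s : ℝ, s * s = 1 ∧ s * D = |D| := by
    rcases hD.lt_or_gt with h | h
    · exact ⟨-1, by norm_num, by rw [abs_of_neg h]; ring⟩
    · exact ⟨1, by norm_num, by rw [abs_of_pos h]; ring⟩
  set c := cross (d 1) (d 2) with hc
  have hDc : ⟪d 0, c⟫_ℝ = D := rfl
  have hd2c : ⟪d 2, c⟫_ℝ = 0 := inner_cross_self_right _ _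
  have hcpos : 0 < ‖c‖ := by
    rw [norm_pos_iff]; rintro h; apply hD; rw [← hDc, h, inner_zero_right]
  have hdpos : 0 < ‖d 2‖ := by
    rw [norm_pos_iff]; rintro h; apply hD; simp [hDdef, det3_eq, h]
  have hDpos : 0 < |D| := abs_pos.2 hD
  have hcn : ‖cross (d 2) c‖ = ‖d 2‖ * ‖c‖ := by
    rw [← sq_eq_sq₀ (norm_nonneg _) (by positivity), norm_cross_sq, hd2c]; ring
  have h1 : ⟪c, cross (d 2) c⟫_ℝ = 0 := inner_cross_self_right _ _
  have h2 : ⟪d 2, cross (d 2) c⟫_ℝ = 0 := inner_cross_self_left _ _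
  have h1' : ⟪cross (d 2) c, c⟫_ℝ = 0 := by rw [real_inner_comm, h1]
  have h2' : ⟪cross (d 2) c, d 2⟫_ℝ = 0 := by rw [real_inner_comm, h2]
  have hcd2 : ⟪c, d 2⟫_ℝ = 0 := by rw [real_inner_comm, hd2c]
  have habs : |s| = 1 := by
    have := abs_mul_abs_self s
    nlinarith [abs_nonneg s]
  refine ⟨![‖c‖⁻¹ • c, (s / (‖d 2‖ * ‖c‖)) • cross (d 2) c, (s / ‖d 2‖) • d 2],
    ![‖c‖, ‖d 2‖ * |D| / ‖c‖, |D| / ‖d 2‖], ⟨?_, ?_⟩, ?_, ?_, ?_, ?_, ?_⟩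
  · intro i
    fin_cases i
    · simp [norm_smul, hcpos.ne']
    · simp [norm_smul, hcn, habs]
      field_simp
    · simp [norm_smul, habs, hdpos.ne']
  · intro i j hij
    fin_cases i <;> fin_cases j <;>
      first
      | exact absurd rfl hij
      | simp [inner_smul_left, inner_smul_right, h1, h2, hd2c, h1', h2', hcd2]
  · intro i
    fin_cases i
    · exact hcpos
    · exact div_pos (mul_pos hdpos hDpos) hcpos
    · exact div_pos hDpos hdpos
  · change ‖c‖ * (‖d 2‖ * |D| / ‖c‖) * (|D| / ‖d 2‖) = D ^ 2
    rw [← sq_abs D]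
    field_simp
  · change ⟪‖c‖⁻¹ • c, c⟫_ℝ = ‖c‖
    rw [real_inner_smul_left, real_inner_self_eq_norm_sq]
    field_simp
  · change ⟪(s / (‖d 2‖ * ‖c‖)) • cross (d 2) c, cross (d 2) (d 0)⟫_ℝ = ‖d 2‖ * |D| / ‖c‖
    rw [real_inner_smul_left, inner_cross_cross, hcd2, real_inner_comm (d 0) c, hDc,
      real_inner_self_eq_norm_sq, ← hsD]
    field_simp
    ring
  · change ⟪(s / ‖d 2‖) • d 2, cross (d 0) (d 1)⟫_ℝ = |D| / ‖d 2‖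
    have : ⟪d 2, cross (d 0) (d 1)⟫_ℝ = D := by
      simp only [hDdef, det3_eq, inner_eq_coord, cross_apply_zero, cross_apply_one,
        cross_apply_two]
      ring
    rw [real_inner_smul_left, this, ← hsD]
    field_simp

/-! ### The area inequality for eight triangles and its equality case -/

theorem norm_sum_sgn_smul {e : Fin 3 → E3} (he : Orthonormal ℝ e) (ε : Fin 3 → Bool) :
    ‖∑ i, sgn (ε i) • e i‖ = √3 := by
  rw [← sq_eq_sq₀ (norm_nonneg _) (Real.sqrt_nonneg _), Real.sq_sqrt (by norm_num),
    ← real_inner_self_eq_norm_sq, he.inner_sum]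
  simp [sgn_mul_self]

theorem twentySeven_mul_le_add_pow_three {a b c : ℝ} (ha : 0 < a) (hb : 0 < b) (hc : 0 < c) :
    27 * (a * b * c) ≤ (a + b + c) ^ 3 := by
  nlinarith [mul_nonneg ha.le (sq_nonneg (b - c)), mul_nonneg hb.le (sq_nonneg (a - c)),
    mul_nonneg hc.le (sq_nonneg (a - b)), mul_nonneg ha.le (sq_nonneg (a - b)),
    mul_nonneg ha.le (sq_nonneg (a - c)), mul_nonneg hb.le (sq_nonneg (a - b)),
    mul_nonneg hb.le (sq_nonneg (b - c)), mul_nonneg hc.le (sq_nonneg (a - c)),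
    mul_nonneg hc.le (sq_nonneg (b - c))]

theorem exists_frame_le_sum_norm_areaVector (x : Fin 3 → Bool → E3)
    (hD : det3 (diagonalVector x 0) (diagonalVector x 1) (diagonalVector x 2) ≠ 0) :
    ∃ e : Fin 3 → E3, Orthonormal ℝ e ∧
      0 < ∑ ε, ⟪signProd ε • areaVector (corners x ε), ∑ i, sgn (ε i) • e i⟫_ℝ ∧
      27 * det3 (diagonalVector x 0) (diagonalVector x 1) (diagonalVector x 2) ^ 2 ≤
        (∑ ε, ⟪signProd ε • areaVector (corners x ε), ∑ i, sgn (ε i) • e i⟫_ℝ) ^ 3 := by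
  obtain ⟨e, t, he, ht, hprod, h0, h1, h2⟩ := exists_orthonormal_frame (diagonalVector x) hD
  refine ⟨e, he, ?_, ?_⟩
  · rw [sum_inner_areaVector, h0, h1, h2]
    have := ht 0
    have := ht 1
    have := ht 2
    positivity
  · rw [sum_inner_areaVector, h0, h1, h2, ← hprod]
    exact twentySeven_mul_le_add_pow_three (ht 0) (ht 1) (ht 2)

theorem inner_le_sqrt_three_mul_norm_areaVector {e : Fin 3 → E3} (he : Orthonormal ℝ e)
    (x : Fin 3 → Bool → E3) (ε : Fin 3 → Bool) :
    ⟪signProd ε • areaVector (corners x ε), ∑ i, sgn (ε i) • e i⟫_ℝ ≤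
      √3 * ‖areaVector (corners x ε)‖ := by
  refine (real_inner_le_norm _ _).trans_eq ?_
  rw [norm_sum_sgn_smul he, norm_smul, Real.norm_eq_abs, abs_signProd]
  ring

/-- For any six points, `27 D² ≤ (√3 S)³`, where `S` is the total area of the eight triangles and
`D` the determinant of the diagonals. -/
theorem det3_sq_le_sum_norm_areaVector (x : Fin 3 → Bool → E3) :
    27 * det3 (diagonalVector x 0) (diagonalVector x 1) (diagonalVector x 2) ^ 2 ≤
      (√3 * ∑ ε, ‖areaVector (corners x ε)‖) ^ 3 := by
  by_cases hD : det3 (diagonalVector x 0) (diagonalVector x 1) (diagonalVector x 2) = 0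
  · rw [hD]
    have : 0 ≤ ∑ ε, ‖areaVector (corners x ε)‖ := Finset.sum_nonneg fun _ _ => norm_nonneg _
    simp only [ne_eq, OfNat.ofNat_ne_zero, not_false_eq_true, zero_pow, mul_zero]
    positivity
  obtain ⟨e, he, hpos, h⟩ := exists_frame_le_sum_norm_areaVector x hD
  refine h.trans (pow_le_pow_left₀ hpos.le ?_ 3)
  rw [Finset.mul_sum]
  exact Finset.sum_le_sum fun ε _ => inner_le_sqrt_three_mul_norm_areaVector he x ε

/-- If the edges of each face `ε` are orthogonal to the normal `∑ k, sgn (ε k) • e k`, the six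
points are the vertices of a regular octahedron with axes `e`. Here `r` may be negative or zero.
-/
theorem exists_regular_of_edges_orthogonal (x : Fin 3 → Bool → E3) {e : Fin 3 → E3}
    (he : Orthonormal ℝ e)
    (h : ∀ (ε : Fin 3 → Bool) i j, ⟪∑ k, sgn (ε k) • e k, x i (ε i) - x j (ε j)⟫_ℝ = 0) :
    ∃ (c : E3) (r : ℝ) (u : OrthonormalBasis (Fin 3) ℝ E3),
      ∀ i b, x i b = c + (sgn b * r) • u i := by
  have hsp : ⊤ ≤ Submodule.span ℝ (range e) := by
    rw [he.linearIndependent.span_eq_top_of_card_eq_finrank' (by simp)]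
  let u := OrthonormalBasis.mk he hsp
  have hu : ∀ k, u k = e k := fun k => by simp [u]
  set X : Fin 3 → Bool → Fin 3 → ℝ := fun i b k => ⟪e k, x i b⟫_ℝ with hX
  have hc : ∀ i b, x i b = X i b 0 • e 0 + X i b 1 • e 1 + X i b 2 • e 2 := fun i b => by
    have := u.sum_repr' (x i b)
    simp only [hu, Fin.sum_univ_three] at this
    exact this.symm
  have key : ∀ (ε : Fin 3 → Bool) i j, sgn (ε 0) * (X i (ε i) 0 - X j (ε j) 0) +
      sgn (ε 1) * (X i (ε i) 1 - X j (ε j) 1) + sgn (ε 2) * (X i (ε i) 2 - X j (ε j) 2) = 0 := by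
    intro ε i j
    rw [← h ε i j]
    simp [hX, Fin.sum_univ_three, inner_add_left, real_inner_smul_left, inner_sub_right]
    ring
  have k01 : ∀ a b c, sgn a * (X 0 a 0 - X 1 b 0) + sgn b * (X 0 a 1 - X 1 b 1) +
      sgn c * (X 0 a 2 - X 1 b 2) = 0 := fun a b c => key ![a, b, c] 0 1
  have k02 : ∀ a b c, sgn a * (X 0 a 0 - X 2 c 0) + sgn b * (X 0 a 1 - X 2 c 1) +
      sgn c * (X 0 a 2 - X 2 c 2) = 0 := fun a b c => key ![a, b, c] 0 2
  have k12 : ∀ a b c, sgn a * (X 1 b 0 - X 2 c 0) + sgn b * (X 1 b 1 - X 2 c 1) +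
      sgn c * (X 1 b 2 - X 2 c 2) = 0 := fun a b c => key ![a, b, c] 1 2
  -- Flipping the sign not seen by an edge separates the coordinate along the third axis.
  have e01 : ∀ a b, X 0 a 2 = X 1 b 2 := fun a b => by
    have h1 := k01 a b true
    have h2 := k01 a b false
    simp only [sgn_true, sgn_false] at h1 h2
    linarith
  have e02 : ∀ a c, X 0 a 1 = X 2 c 1 := fun a c => by
    have h1 := k02 a true c
    have h2 := k02 a false c
    simp only [sgn_true, sgn_false] at h1 h2
    linarith
  have e12 : ∀ b c, X 1 b 0 = X 2 c 0 := fun b c => by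
    have h1 := k12 true b c
    have h2 := k12 false b c
    simp only [sgn_true, sgn_false] at h1 h2
    linarith
  set c0 := X 1 true 0
  set c1 := X 0 true 1
  set c2 := X 0 true 2
  set r := X 0 true 0 - c0 with hr
  have b0 : ∀ b, X 1 b 0 = c0 := fun b => (e12 b true).trans (e12 true true).symm
  have b1 : ∀ b, X 0 b 1 = c1 := fun b => (e02 b true).trans (e02 true true).symm
  have b2 : ∀ b, X 0 b 2 = c2 := fun b => (e01 b true).trans (e01 true true).symm
  have f0 : ∀ b, X 2 b 0 = c0 := fun b => (e12 true b).symm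
  have f1 : ∀ b, X 2 b 1 = c1 := fun b => (e02 true b).symm
  have f2 : ∀ b, X 1 b 2 = c2 := fun b => (e01 true b).symm
  have d1 : ∀ b, X 1 b 1 = c1 + sgn b * r := fun b => by
    have h1 := k01 true b true
    rw [b0, b1, b2, f2] at h1
    cases b <;> simp only [sgn_true, sgn_false] at h1 ⊢ <;> linarith
  have d2 : ∀ b, X 2 b 2 = c2 + sgn b * r := fun b => by
    have h1 := k02 true true b
    rw [f0, b1, f1, b2] at h1
    cases b <;> simp only [sgn_true, sgn_false] at h1 ⊢ <;> linarith
  have d0 : ∀ b, X 0 b 0 = c0 + sgn b * r := fun b => by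
    have h1 := k01 b true true
    have h2 := d1 true
    rw [b0, b1, b2, f2] at h1
    cases b <;> simp only [sgn_true, sgn_false] at h1 h2 ⊢ <;> linarith
  refine ⟨c0 • e 0 + c1 • e 1 + c2 • e 2, r, u, fun i b => ?_⟩
  rw [hc i b, hu]
  fin_cases i
  · simp only [Fin.zero_eta, d0, b1, b2]; module
  · simp only [Fin.mk_one, b0, d1, f2]; module
  · simp only [Fin.reduceFinMk, f0, f1, d2]; module

/-- The equality case: all Cauchy-Schwarz inequalities between area vectors and normals are tight.
-/
theorem exists_regular_of_sum_norm_areaVector_eq (x : Fin 3 → Bool → E3)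
    (hD : det3 (diagonalVector x 0) (diagonalVector x 1) (diagonalVector x 2) ≠ 0)
    (hA : ∀ ε, areaVector (corners x ε) ≠ 0)
    (heq : (√3 * ∑ ε, ‖areaVector (corners x ε)‖) ^ 3 =
      27 * det3 (diagonalVector x 0) (diagonalVector x 1) (diagonalVector x 2) ^ 2) :
    ∃ (c : E3) (r : ℝ) (u : OrthonormalBasis (Fin 3) ℝ E3),
      ∀ i b, x i b = c + (sgn b * r) • u i := by
  obtain ⟨e, he, hpos, h⟩ := exists_frame_le_sum_norm_areaVector x hD
  rw [← heq] at h
  have hle := le_of_pow_le_pow_left₀ (by norm_num) hpos.le h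
  rw [Finset.mul_sum] at hle
  have hall := (Finset.sum_eq_sum_iff_of_le fun ε (_ : ε ∈ Finset.univ) =>
    inner_le_sqrt_three_mul_norm_areaVector he x ε).1
    (le_antisymm (Finset.sum_le_sum fun ε _ =>
      inner_le_sqrt_three_mul_norm_areaVector he x ε) hle)
  refine exists_regular_of_edges_orthogonal x he fun ε i j => ?_
  have h1 := hall ε (Finset.mem_univ _)
  have hnorm : ‖signProd ε • areaVector (corners x ε)‖ = ‖areaVector (corners x ε)‖ := by
    rw [norm_smul, Real.norm_eq_abs, abs_signProd, one_mul]
  have h2 : ⟪signProd ε • areaVector (corners x ε), ∑ i, sgn (ε i) • e i⟫_ℝ =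
      ‖signProd ε • areaVector (corners x ε)‖ * ‖∑ i, sgn (ε i) • e i‖ := by
    rw [h1, norm_sum_sgn_smul he, hnorm, mul_comm]
  rw [inner_eq_norm_mul_iff_real, hnorm] at h2
  have h3 : ⟪‖areaVector (corners x ε)‖ • ∑ i, sgn (ε i) • e i, x i (ε i) - x j (ε j)⟫_ℝ = 0 := by
    rw [← h2, real_inner_smul_left, real_inner_smul_left]
    have := inner_areaVector_edge (corners x ε) i j
    simp only [corners] at this ⊢
    rw [this]; simp
  rw [real_inner_smul_left] at h3
  exact (mul_eq_zero.1 h3).resolve_left (norm_ne_zero_iff.2 (hA ε))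

/-! ### Determinants of triangles in the boundary of a convex body -/

section Convex

variable {E : Type*} [NormedAddCommGroup E] [NormedSpace ℝ E] {P : Set E} {o : E}

/-- A ray from an interior point of a closed convex set meets the frontier at most once. -/
theorem eq_one_of_mem_frontier_of_sub_eq_smul (hP : Convex ℝ P) (hPc : IsClosed P)
    (ho : o ∈ interior P) {p q : E} (hp : p ∈ frontier P) (hq : q ∈ frontier P) {t : ℝ}
    (ht : 0 < t) (h : q - o = t • (p - o)) : t = 1 := by
  have key : ∀ {p q : E} {t : ℝ}, p ∈ frontier P → q ∈ frontier P → 0 < t →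
      q - o = t • (p - o) → ¬ t < 1 := by
    intro p q t hp hq ht h ht1
    refine hq.2 (hP.openSegment_interior_self_subset_interior ho (hPc.frontier_subset hp)
      ⟨1 - t, t, by linarith, ht, by ring, ?_⟩)
    rw [sub_eq_iff_eq_add.1 h]
    module
  rcases lt_trichotomy t 1 with h1 | h1 | h1
  · exact absurd h1 (key hp hq ht h)
  · exact h1
  · exact absurd (inv_lt_one_of_one_lt₀ h1) (key hq hp (inv_pos.2 ht)
      (by rw [h, smul_smul, inv_mul_cancel₀ ht.ne', one_smul]))

/-- A ray from a point of a bounded set meets the frontier. -/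
theorem exists_add_smul_mem_frontier (hPb : Bornology.IsBounded P) {p v : E} (hp : p ∈ P)
    (hv : v ≠ 0) : ∃ t : ℝ, 0 ≤ t ∧ p + t • v ∈ frontier P := by
  obtain ⟨R, hR⟩ := hPb.subset_ball p
  let f : ℝ → E := fun t => p + t • v
  have hf : Continuous f := by fun_prop
  by_contra! hcon
  have hpre : IsPreconnected (f '' Ici 0) := isPreconnected_Ici.image f hf.continuousOn
  have hvpos : 0 < ‖v‖ := norm_pos_iff.2 hv
  have hRpos : 0 < R := by simpa using Metric.nonempty_ball.1 ⟨p, hR hp⟩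
  have hout : f (R / ‖v‖) ∉ P := fun h => by
    have := hR h
    rw [Metric.mem_ball, dist_eq_norm, add_sub_cancel_left, norm_smul, Real.norm_eq_abs,
      abs_of_pos (by positivity), div_mul_cancel₀ _ hvpos.ne'] at this
    exact lt_irrefl _ this
  have hsub : f '' Ici 0 ⊆ interior P ∪ (closure P)ᶜ := by
    rintro _ ⟨t, ht, rfl⟩
    by_contra h
    rw [mem_union, not_or, mem_compl_iff, not_not] at h
    exact hcon t ht ⟨h.2, h.1⟩
  obtain ⟨y, -, hy1, hy2⟩ := hpre _ _ isOpen_interior isClosed_closure.isOpen_compl hsub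
    ⟨p, ⟨0, by simp, by simp [f]⟩, by
      rcases hsub ⟨0, by simp, rfl⟩ with h | h
      · simpa [f] using h
      · exact absurd (subset_closure hp) (by simpa [f] using h)⟩
    ⟨f (R / ‖v‖), ⟨_, by simp only [mem_Ici]; positivity, rfl⟩, by
      rcases hsub ⟨R / ‖v‖, by simp only [mem_Ici]; positivity, rfl⟩ with h | h
      · exact absurd (interior_subset h) hout
      · exact h⟩
  exact hy2 (subset_closure (interior_subset hy1))

end Convex

/-- Cramer's rule. -/
theorem det3_smul_eq (a b c v : E3) :
    det3 a b c • v = det3 v b c • a + det3 a v c • b + det3 a b v • c := by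
  ext i
  fin_cases i <;> simp [det3_eq] <;> ring

theorem exists_of_det3_eq_zero {a b c : E3} (h : det3 a b c = 0) :
    ∃ g : Fin 3 → ℝ, g ≠ 0 ∧ g 0 • a + g 1 • b + g 2 • c = 0 := by
  have hdet : (Matrix.of ![a.ofLp, b.ofLp, c.ofLp]).det = 0 := by
    rw [← h, Matrix.det_fin_three, det3_eq]
    simp
    ring
  obtain ⟨g, hg, hg0⟩ := Matrix.exists_vecMul_eq_zero_iff.2 hdet
  refine ⟨g, hg, ?_⟩
  ext i
  have := congrFun hg0 i
  fin_cases i <;> simpa [Matrix.vecMul, dotProduct, Fin.sum_univ_three] using this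

theorem mem_convexHull_triple {E : Type*} [AddCommGroup E] [Module ℝ E] {a b c : E} {α β γ : ℝ}
    (hα : 0 ≤ α) (hβ : 0 ≤ β) (hγ : 0 ≤ γ) (h : α + β + γ = 1) :
    α • a + β • b + γ • c ∈ convexHull ℝ {a, b, c} := by
  have hr : ({a, b, c} : Set E) = range ![a, b, c] := by
    simp only [Matrix.range_cons, Matrix.range_empty, union_empty, singleton_union]
  rw [hr, mem_convexHull_range_iff]
  refine ⟨![α, β, γ], ?_, ?_, ?_⟩
  · intro i; fin_cases i <;> simpa
  · simpa [Fin.sum_univ_three] using h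
  · simp [Fin.sum_univ_three]

theorem exists_pos_add_mul_nonneg (h : Fin 3 → ℝ) (m : ℝ) (hm : 0 < m) :
    ∃ δ : ℝ, 0 < δ ∧ δ < 1 ∧ ∀ i, 0 ≤ m + δ * h i := by
  have hS : 0 ≤ ∑ i, |h i| := Finset.sum_nonneg fun _ _ => abs_nonneg _
  refine ⟨m / (m + 1 + ∑ i, |h i|), by positivity, ?_, fun i => ?_⟩
  · rw [div_lt_one (by positivity)]; linarith
  · have h1 : |h i| ≤ ∑ i, |h i| := Finset.single_le_sum (f := fun i => |h i|)
      (fun _ _ => abs_nonneg _) (Finset.mem_univ i)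
    have h2 := neg_abs_le (h i)
    rw [div_mul_eq_mul_div, ← mul_div_assoc', ← mul_one_add]
    refine mul_nonneg hm.le ?_
    have : -1 ≤ h i / (m + 1 + ∑ i, |h i|) := by
      rw [le_div_iff₀ (by positivity)]; linarith
    linarith

/-- If the plane of the triangle contained `o`, then moving the centroid slightly away from `o`
would keep it in the triangle, so a ray from `o` would meet the frontier twice. -/
theorem det3_ne_zero_of_subset_frontier {P : Set E3} {o : E3} (hP : Convex ℝ P) (hPc : IsClosed P)
    (ho : o ∈ interior P) {T : Fin 3 → E3} (hT : AffineIndependent ℝ T)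
    (hsub : convexHull ℝ (range T) ⊆ frontier P) :
    det3 (T 0 - o) (T 1 - o) (T 2 - o) ≠ 0 := by
  intro h
  obtain ⟨g, hg, hg0⟩ := exists_of_det3_eq_zero h
  have hgs : g 0 • T 0 + g 1 • T 1 + g 2 • T 2 = (g 0 + g 1 + g 2) • o := by
    rw [← sub_eq_zero, ← hg0]; module
  by_cases hs : g 0 + g 1 + g 2 = 0
  · rw [hs, zero_smul] at hgs
    refine hg (funext fun i => ?_)
    have := (affineIndependent_iff.1 hT) Finset.univ g (by simpa [Fin.sum_univ_three] using hs)
      (by simpa [Fin.sum_univ_three] using hgs) i (Finset.mem_univ i)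
    simpa using this
  · set s := g 0 + g 1 + g 2 with hsdef
    have ho' : o = (g 0 / s) • T 0 + (g 1 / s) • T 1 + (g 2 / s) • T 2 := by
      have : o = s⁻¹ • (s • o) := by rw [smul_smul, inv_mul_cancel₀ hs, one_smul]
      rw [this, ← hgs]; module
    have hone : g 0 / s + g 1 / s + g 2 / s = 1 := by
      field_simp; exact hsdef.symm
    -- Move from the centroid of the triangle away from `o`, staying in the triangle.
    obtain ⟨δ, hδ, -, hw⟩ := exists_pos_add_mul_nonneg (fun i => 1 / 3 - g i / s) (1 / 3)
      (by norm_num)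
    have hp : ∑ i, (1 / 3 : ℝ) • T i ∈ convexHull ℝ (range T) :=
      mem_convexHull_range_iff.2 ⟨fun _ => 1 / 3, fun _ => by norm_num, by simp, rfl⟩
    have hq : ∑ i, (1 / 3 + δ * (1 / 3 - g i / s)) • T i ∈ convexHull ℝ (range T) :=
      mem_convexHull_range_iff.2 ⟨_, hw, by
        rw [Fin.sum_univ_three]; linear_combination -δ * hone, rfl⟩
    have := eq_one_of_mem_frontier_of_sub_eq_smul hP hPc ho (hsub hp) (hsub hq) (t := 1 + δ)
      (by linarith) (by
        rw [Fin.sum_univ_three, Fin.sum_univ_three]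
        have : (1 + δ) • o = o + δ • ((g 0 / s) • T 0 + (g 1 / s) • T 1 + (g 2 / s) • T 2) := by
          rw [← ho']; module
        rw [smul_sub, this]
        module)
    linarith

/-- Two triangles in the frontier with the common edge `a b` have their third corners on opposite
sides of the plane through `o` and this edge: otherwise the cones from `o` over the triangles
would overlap near the edge, and since a ray from `o` meets the frontier only once, the triangles
would share a point off the common edge. -/
theorem det3_mul_det3_neg_of_adjacent {P : Set E3} {o : E3} (hP : Convex ℝ P) (hPc : IsClosed P)
    (ho : o ∈ interior P) {a b c c' : E3}
    (h : convexHull ℝ {a, b, c} ⊆ frontier P) (h' : convexHull ℝ {a, b, c'} ⊆ frontier P)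
    (hi : convexHull ℝ {a, b, c} ∩ convexHull ℝ {a, b, c'} ⊆ convexHull ℝ {a, b})
    (hd : det3 (a - o) (b - o) (c - o) ≠ 0) (hd' : det3 (a - o) (b - o) (c' - o) ≠ 0) :
    det3 (a - o) (b - o) (c - o) * det3 (a - o) (b - o) (c' - o) < 0 := by
  by_contra hcon
  set D := det3 (a - o) (b - o) (c - o) with hD
  set D' := det3 (a - o) (b - o) (c' - o) with hD'
  have hpos : 0 < D * D' := lt_of_le_of_ne (not_lt.1 hcon) (mul_ne_zero hd hd').symm
  set α := det3 (c' - o) (b - o) (c - o) / D with hα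
  set β := det3 (a - o) (c' - o) (c - o) / D with hβ
  set γ := D' / D with hγ
  have hγpos : 0 < γ := by
    rw [hγ, show D' / D = D * D' / (D * D) by field_simp]
    exact div_pos hpos (mul_self_pos.2 hd)
  have hc' : c' - o = α • (a - o) + β • (b - o) + γ • (c - o) := by
    have : c' - o = D⁻¹ • (D • (c' - o)) := by rw [smul_smul, inv_mul_cancel₀ hd, one_smul]
    rw [this, hD, det3_smul_eq, ← hD, ← hD', hα, hβ, hγ]
    module
  -- A point of the second triangle near the common edge has positive coordinates in the first.
  obtain ⟨δ, hδ, hδ1, hw⟩ := exists_pos_add_mul_nonneg ![α - 1 / 2, β - 1 / 2, 0] (1 / 2)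
    (by norm_num)
  have hw0 : 0 ≤ 1 / 2 + δ * (α - 1 / 2) := hw 0
  have hw1 : 0 ≤ 1 / 2 + δ * (β - 1 / 2) := hw 1
  set W := (1 / 2 + δ * (α - 1 / 2)) + (1 / 2 + δ * (β - 1 / 2)) + δ * γ with hW
  have hδγ : 0 < δ * γ := mul_pos hδ hγpos
  have hWpos : 0 < W := by linarith
  have hq : ((1 - δ) / 2) • a + ((1 - δ) / 2) • b + δ • c' ∈ convexHull ℝ {a, b, c'} :=
    mem_convexHull_triple (by linarith) (by linarith) hδ.le (by ring)
  have hp : ((1 / 2 + δ * (α - 1 / 2)) / W) • a + ((1 / 2 + δ * (β - 1 / 2)) / W) • b +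
      (δ * γ / W) • c ∈ convexHull ℝ {a, b, c} :=
    mem_convexHull_triple (by positivity) (by positivity) (by positivity)
      (by rw [← add_div, ← add_div, ← hW, div_self hWpos.ne'])
  set q := ((1 - δ) / 2) • a + ((1 - δ) / 2) • b + δ • c' with hqdef
  have hqo : q - o = (1 / 2 + δ * (α - 1 / 2)) • (a - o) + (1 / 2 + δ * (β - 1 / 2)) • (b - o) +
      (δ * γ) • (c - o) := by
    have : q - o = ((1 - δ) / 2) • (a - o) + ((1 - δ) / 2) • (b - o) + δ • (c' - o) := by
      rw [hqdef]; module
    rw [this, hc']; module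
  set p := ((1 / 2 + δ * (α - 1 / 2)) / W) • a + ((1 / 2 + δ * (β - 1 / 2)) / W) • b +
      (δ * γ / W) • c with hpdef
  have hpo : q - o = W • (p - o) := by
    have h1 : W • p = (1 / 2 + δ * (α - 1 / 2)) • a + (1 / 2 + δ * (β - 1 / 2)) • b +
        (δ * γ) • c := by
      rw [hpdef]
      simp only [smul_add, smul_smul, mul_div_cancel₀ _ hWpos.ne']
    rw [hqo, smul_sub W p o, h1, hW]
    module
  have hW1 := eq_one_of_mem_frontier_of_sub_eq_smul hP hPc ho (h hp) (h' hq) hWpos hpo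
  have hqp : q = p := by
    rw [hW1, one_smul] at hpo
    exact sub_left_injective hpo
  have hqi := hi ⟨hqp ▸ hp, hq⟩
  rw [convexHull_pair] at hqi
  obtain ⟨s, t, -, -, hst, hqs⟩ := hqi
  have hzero : det3 (a - o) (b - o) (q - o) = 0 := by
    have : q - o = s • (a - o) + t • (b - o) := by
      rw [← hqs, show s • (a - o) + t • (b - o) = s • a + t • b - (s + t) • o by module, hst,
        one_smul]
    rw [this]
    simp only [det3_eq, PiLp.add_apply, PiLp.smul_apply, smul_eq_mul]
    ring
  have hne : det3 (a - o) (b - o) (q - o) = δ * γ * D := by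
    rw [hqo, hD]
    simp only [det3_eq, PiLp.add_apply, PiLp.smul_apply, smul_eq_mul]
    ring
  rw [hne] at hzero
  exact (mul_ne_zero hδγ.ne' hd) hzero

/-! ### Octahedral surfaces -/

/-- The points `x i b` are the vertices of a triangulation of the boundary of `P` whose faces are
the eight triangles `corners x ε`. The intersection of two faces is required to lie in the hull of
their common corners. -/
structure IsOctahedralSurface (P : Set E3) (x : Fin 3 → Bool → E3) : Prop where
  affineIndependent : ∀ ε, AffineIndependent ℝ (corners x ε)
  frontier_eq : frontier P = ⋃ ε, convexHull ℝ (range (corners x ε))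
  inter_subset : ∀ ε ε', convexHull ℝ (range (corners x ε)) ∩ convexHull ℝ (range (corners x ε')) ⊆
    convexHull ℝ (corners x ε '' {i | ε i = ε' i})

theorem mem_faces_octahedronComplex {s : Finset (Fin 3 × Bool)} :
    s ∈ octahedronComplex.faces ↔
      s.Nonempty ∧ ∀ i : Fin 3, ¬((i, true) ∈ s ∧ (i, false) ∈ s) := Iff.rfl

/-- A combinatorial equivalence with the boundary complex of the octahedron labels the vertices of
the complex by `Fin 3 × Bool`, so that its faces are exactly the images of the octahedral ones. -/
theorem SameCombinatorialType.exists_vertex_embedding {K : Geometry.SimplicialComplex ℝ E3}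
    (hoct : SameCombinatorialType K.toPreAbstractSimplicialComplex octahedronComplex) :
    ∃ φ : Fin 3 × Bool ↪ E3,
      (∀ u : Finset (Fin 3 × Bool), u.map φ ∈ K.faces ↔ u ∈ octahedronComplex.faces) ∧
      ∀ t ∈ K.faces, ∃ u : Finset (Fin 3 × Bool), u.map φ = t := by
  classical
  obtain ⟨e, he⟩ := hoct
  have hvert : ∀ p : Fin 3 × Bool, {p} ∈ octahedronComplex.faces := fun p => by
    rw [mem_faces_octahedronComplex]
    refine ⟨by simp, fun i => ?_⟩
    rintro ⟨h1, h2⟩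
    rw [Finset.mem_singleton] at h1 h2
    exact absurd (h1.trans h2.symm) (by simp)
  let ψ : Fin 3 × Bool ↪ VertexType K.toPreAbstractSimplicialComplex :=
    ⟨fun p => e.symm ⟨p, hvert p⟩, fun p q h => by simpa using h⟩
  refine ⟨ψ.trans (Function.Embedding.subtype _), fun u => ?_, fun t ht => ?_⟩
  · have h := he (u.map ψ)
    rw [Finset.map_map, Finset.map_map, Finset.map_map] at h
    have h2 : ψ.trans (e.toEmbedding.trans (Function.Embedding.subtype _)) =
        Function.Embedding.refl _ :=
      Function.Embedding.ext fun p => congrArg Subtype.val (e.apply_symm_apply ⟨p, hvert p⟩)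
    rw [h2, Finset.map_refl] at h
    exact h
  · refine ⟨Finset.univ.filter fun p => (ψ p).1 ∈ t, ?_⟩
    ext v
    rw [Finset.mem_map]
    constructor
    · rintro ⟨p, hp, rfl⟩
      exact (Finset.mem_filter.1 hp).2
    · intro hv
      have hv1 : {v} ∈ K.faces := K.down_closed ht (by simpa using hv) (by simp)
      have : (ψ (e ⟨v, hv1⟩).1).1 = v := congrArg Subtype.val (e.symm_apply_apply ⟨v, hv1⟩)
      exact ⟨_, Finset.mem_filter.2 ⟨Finset.mem_univ _, by rwa [this]⟩, this⟩

theorem exists_isOctahedralSurface {P : Set E3} {K : Geometry.SimplicialComplex ℝ E3}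
    (hK : K.space = frontier P)
    (hoct : SameCombinatorialType K.toPreAbstractSimplicialComplex octahedronComplex) :
    ∃ x, IsOctahedralSurface P x := by
  classical
  obtain ⟨φ, hface, hsurj⟩ := hoct.exists_vertex_embedding
  have hU : ∀ ε : Fin 3 → Bool, (Finset.univ.image fun i => (i, ε i)).map φ ∈ K.faces := fun ε => by
    rw [hface, mem_faces_octahedronComplex]
    refine ⟨⟨(0, ε 0), by simp⟩, fun i => ?_⟩
    simp only [Finset.mem_image, Finset.mem_univ, true_and, Prod.mk.injEq]
    rintro ⟨⟨j, rfl, h1⟩, ⟨k, rfl, h2⟩⟩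
    simp [h1] at h2
  have hrange : ∀ ε : Fin 3 → Bool, range (corners (fun i b => φ (i, b)) ε) =
      ((Finset.univ.image fun i => (i, ε i)).map φ : Finset E3) := fun ε => by
    ext v; simp [corners]
  refine ⟨fun i b => φ (i, b), ⟨fun ε => ?_, ?_, fun ε ε' => ?_⟩⟩
  · have hmem : ∀ i, corners (fun i b => φ (i, b)) ε i ∈
        (Finset.univ.image fun i => (i, ε i)).map φ := fun i => by
      rw [← Finset.mem_coe, ← hrange]; exact mem_range_self i
    have hinj : Function.Injective fun i =>
        (⟨corners (fun i b => φ (i, b)) ε i, hmem i⟩ :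
          ((Finset.univ.image fun i => (i, ε i)).map φ : Finset E3)) := fun i j h => by
      have h1 : φ (i, ε i) = φ (j, ε j) := congrArg Subtype.val h
      exact congrArg Prod.fst (φ.injective h1)
    exact (K.indep (hU ε)).comp_embedding ⟨_, hinj⟩
  · rw [← hK]
    ext v
    rw [Geometry.SimplicialComplex.mem_space_iff, mem_iUnion]
    constructor
    · rintro ⟨t, ht, hv⟩
      obtain ⟨u, rfl⟩ := hsurj t ht
      have hu := ((mem_faces_octahedronComplex).1 ((hface u).1 ht)).2
      refine ⟨fun i => decide ((i, true) ∈ u), convexHull_mono ?_ hv⟩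
      rw [Finset.coe_map]
      rintro _ ⟨⟨i, b⟩, hp, rfl⟩
      refine ⟨i, ?_⟩
      have : decide ((i, true) ∈ u) = b := by
        cases b
        · simpa using fun h => hu i ⟨h, hp⟩
        · simpa using hp
      simp [corners, this]
    · rintro ⟨ε, hv⟩
      rw [hrange] at hv
      exact ⟨_, hU ε, hv⟩
  · rw [hrange, hrange]
    refine (K.inter_subset_convexHull (hU ε) (hU ε')).trans (convexHull_mono ?_)
    rw [← hrange, ← hrange]
    rintro _ ⟨⟨i, rfl⟩, ⟨j, hj⟩⟩
    refine ⟨i, ?_, rfl⟩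
    have h1 : φ (j, ε' j) = φ (i, ε i) := hj
    have h2 := φ.injective h1
    rw [Prod.mk.injEq] at h2
    obtain ⟨rfl, h⟩ := h2
    exact h.symm

/-- A segment is a degenerate triangle. -/
theorem euclideanHausdorffMeasure_two_convexHull_pair (a b : E3) :
    Measure.euclideanHausdorffMeasure 2 (convexHull ℝ {a, b}) = 0 := by
  have h : ({a, b} : Set E3) = range ![a, b, b] := by
    simp only [Matrix.range_cons, Matrix.range_empty, union_empty, singleton_union,
      pair_eq_singleton]
  rw [h, euclideanHausdorffMeasure_triangle]
  have : areaVector ![a, b, b] = 0 := by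
    ext i; fin_cases i <;> simp [areaVector] <;> ring
  simp [this]

theorem det3_rotate (u v w : E3) : det3 u v w = det3 v w u := by
  simp only [det3_eq]; ring

theorem insert_rotate {α : Type*} (u v w : α) : ({u, v, w} : Set α) = {v, w, u} := by
  ext; simp only [mem_insert_iff, mem_singleton_iff]; tauto

/-- A function of three signs that changes sign with each of them has the sign pattern of their
product. -/
theorem sgn_mul_pos_of_flip_neg (D : Bool → Bool → Bool → ℝ)
    (h0 : ∀ b c, D true b c * D false b c < 0) (h1 : ∀ a c, D a true c * D a false c < 0)
    (h2 : ∀ a b, D a b true * D a b false < 0) (a b c : Bool) :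
    0 < (sgn a * sgn b * sgn c * D a b c) * D true true true := by
  have same : ∀ p q r : ℝ, 0 < p * q → 0 < q * r → 0 < p * r := fun p q r h h' => by
    rcases mul_pos_iff.1 h' with ⟨hq, hr⟩ | ⟨hq, hr⟩ <;> nlinarith
  have hne : ∀ a b c, D a b c ≠ 0 := fun a b c => by
    cases c
    · exact right_ne_zero_of_mul (h2 a b).ne
    · exact left_ne_zero_of_mul (h2 a b).ne
  have e0 : 0 < sgn a * D a b c * D true b c := by
    cases a
    · simpa [mul_comm] using h0 b c
    · simpa using hne true b c
  have e1 : 0 < sgn b * D true b c * D true true c := by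
    cases b
    · simpa [mul_comm] using h1 true c
    · simpa using hne true true c
  have e2 : 0 < sgn c * D true true c * D true true true := by
    cases c
    · simpa [mul_comm] using h2 true true
    · simpa using hne true true true
  have e01 : 0 < sgn a * sgn b * D a b c * D true true c := by
    refine same _ (sgn b * D true b c) _ ?_ e1
    calc 0 < sgn a * D a b c * D true b c * (sgn b * sgn b) := by rwa [sgn_mul_self, mul_one]
      _ = _ := by ring
  refine same _ (sgn c * D true true c) _ ?_ e2
  calc 0 < sgn a * sgn b * D a b c * D true true c * (sgn c * sgn c) := by
        rwa [sgn_mul_self, mul_one]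
    _ = _ := by ring

namespace IsOctahedralSurface

variable {P : Set E3} {x : Fin 3 → Bool → E3}

theorem convexHull_subset_frontier (h : IsOctahedralSurface P x) (ε : Fin 3 → Bool) :
    convexHull ℝ (range (corners x ε)) ⊆ frontier P := by
  rw [h.frontier_eq]; exact subset_iUnion (fun ε => convexHull ℝ (range (corners x ε))) ε

theorem surfaceArea_eq (h : IsOctahedralSurface P x) :
    surfaceArea P = ∑ ε, ‖areaVector (corners x ε)‖ := by
  rw [surfaceArea, h.frontier_eq, measure_iUnion₀]
  · simp_rw [euclideanHausdorffMeasure_triangle]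
    rw [tsum_fintype, ENNReal.toReal_sum fun _ _ => ENNReal.ofReal_ne_top]
    simp
  · intro ε ε' hne
    obtain ⟨k, hk⟩ := Function.ne_iff.1 hne
    -- Distinct faces differ at some `k`, so they share at most the edge opposite to the corner `k`.
    refine measure_mono_null ((h.inter_subset ε ε').trans (convexHull_mono ?_))
      (euclideanHausdorffMeasure_two_convexHull_pair (corners x ε (k + 1)) (corners x ε (k + 2)))
    rintro _ ⟨i, hi, rfl⟩
    have hik : i ≠ k := by rintro rfl; exact hk hi
    have hcyc : ∀ i k : Fin 3, i ≠ k → i = k + 1 ∨ i = k + 2 := by decide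
    rcases hcyc i k hik with rfl | rfl <;> simp
  · exact fun ε =>
      ((finite_range _).isCompact_convexHull (𝕜 := ℝ)).isClosed.measurableSet.nullMeasurableSet

theorem det3_ne_zero (h : IsOctahedralSurface P x) (hP : Convex ℝ P) (hPc : IsClosed P) {o : E3}
    (ho : o ∈ interior P) (ε : Fin 3 → Bool) :
    det3 (x 0 (ε 0) - o) (x 1 (ε 1) - o) (x 2 (ε 2) - o) ≠ 0 := by
  have := det3_ne_zero_of_subset_frontier hP hPc ho (h.affineIndependent ε)
    (h.convexHull_subset_frontier ε)
  simpa only [corners] using this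

theorem range_corners (x : Fin 3 → Bool → E3) (a b c : Bool) :
    range (corners x ![a, b, c]) = {x 0 a, x 1 b, x 2 c} := by
  ext v; simp [corners, Fin.exists_fin_succ, eq_comm]

theorem convexHull_triple_subset_frontier (h : IsOctahedralSurface P x) (a b c : Bool) :
    convexHull ℝ {x 0 a, x 1 b, x 2 c} ⊆ frontier P := by
  rw [← range_corners]; exact h.convexHull_subset_frontier _

theorem inter_subset_triple (h : IsOctahedralSurface P x) (a b c a' b' c' : Bool) :
    convexHull ℝ {x 0 a, x 1 b, x 2 c} ∩ convexHull ℝ {x 0 a', x 1 b', x 2 c'} ⊆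
      convexHull ℝ (corners x ![a, b, c] '' {i | ![a, b, c] i = ![a', b', c'] i}) := by
  rw [← range_corners, ← range_corners]; exact h.inter_subset _ _

theorem det3_mul_det3_neg_of_flip_two (h : IsOctahedralSurface P x) (hP : Convex ℝ P)
    (hPc : IsClosed P) {o : E3} (ho : o ∈ interior P) (a b : Bool) :
    det3 (x 0 a - o) (x 1 b - o) (x 2 true - o) *
      det3 (x 0 a - o) (x 1 b - o) (x 2 false - o) < 0 := by
  refine det3_mul_det3_neg_of_adjacent hP hPc ho (h.convexHull_triple_subset_frontier a b true)
    (h.convexHull_triple_subset_frontier a b false)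
    ((h.inter_subset_triple a b true a b false).trans (convexHull_mono ?_))
    (h.det3_ne_zero hP hPc ho ![a, b, true]) (h.det3_ne_zero hP hPc ho ![a, b, false])
  rintro _ ⟨i, hi, rfl⟩
  fin_cases i
  · simp [corners]
  · simp [corners]
  · simp at hi

theorem det3_mul_det3_neg_of_flip_one (h : IsOctahedralSurface P x) (hP : Convex ℝ P)
    (hPc : IsClosed P) {o : E3} (ho : o ∈ interior P) (a c : Bool) :
    det3 (x 0 a - o) (x 1 true - o) (x 2 c - o) *
      det3 (x 0 a - o) (x 1 false - o) (x 2 c - o) < 0 := by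
  have hD1 := h.det3_ne_zero hP hPc ho ![a, true, c]
  have hD2 := h.det3_ne_zero hP hPc ho ![a, false, c]
  have s1 := h.convexHull_triple_subset_frontier a true c
  have s2 := h.convexHull_triple_subset_frontier a false c
  have i1 := h.inter_subset_triple a true c a false c
  rw [← insert_rotate (x 2 c)] at s1 s2
  rw [← insert_rotate (x 2 c) _ (x 1 true), ← insert_rotate (x 2 c) _ (x 1 false)] at i1
  rw [← det3_rotate (x 2 c - o) _ (x 1 true - o), ← det3_rotate (x 2 c - o) _ (x 1 false - o)]
  refine det3_mul_det3_neg_of_adjacent hP hPc ho s1 s2 (i1.trans (convexHull_mono ?_))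
    (by rw [det3_rotate]; exact hD1) (by rw [det3_rotate]; exact hD2)
  rintro _ ⟨i, hi, rfl⟩
  fin_cases i
  · simp [corners]
  · simp at hi
  · simp [corners]

theorem det3_mul_det3_neg_of_flip_zero (h : IsOctahedralSurface P x) (hP : Convex ℝ P)
    (hPc : IsClosed P) {o : E3} (ho : o ∈ interior P) (b c : Bool) :
    det3 (x 0 true - o) (x 1 b - o) (x 2 c - o) *
      det3 (x 0 false - o) (x 1 b - o) (x 2 c - o) < 0 := by
  have hD1 := h.det3_ne_zero hP hPc ho ![true, b, c]
  have hD2 := h.det3_ne_zero hP hPc ho ![false, b, c]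
  have s1 := h.convexHull_triple_subset_frontier true b c
  have s2 := h.convexHull_triple_subset_frontier false b c
  have i1 := h.inter_subset_triple true b c false b c
  rw [insert_rotate] at s1 s2
  rw [insert_rotate (x 0 true), insert_rotate (x 0 false)] at i1
  rw [det3_rotate (x 0 true - o), det3_rotate (x 0 false - o)]
  refine det3_mul_det3_neg_of_adjacent hP hPc ho s1 s2 (i1.trans (convexHull_mono ?_))
    (by rw [← det3_rotate]; exact hD1) (by rw [← det3_rotate]; exact hD2)
  rintro _ ⟨i, hi, rfl⟩
  fin_cases i
  · simp at hi
  · simp [corners]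
  · simp [corners]

theorem signProd_mul_det3_same_sign (h : IsOctahedralSurface P x) (hP : Convex ℝ P)
    (hPc : IsClosed P) {o : E3} (ho : o ∈ interior P) (ε : Fin 3 → Bool) :
    0 < (signProd ε * det3 (x 0 (ε 0) - o) (x 1 (ε 1) - o) (x 2 (ε 2) - o)) *
      det3 (x 0 true - o) (x 1 true - o) (x 2 true - o) :=
  sgn_mul_pos_of_flip_neg (fun a b c => det3 (x 0 a - o) (x 1 b - o) (x 2 c - o))
    (h.det3_mul_det3_neg_of_flip_zero hP hPc ho) (h.det3_mul_det3_neg_of_flip_one hP hPc ho)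
    (h.det3_mul_det3_neg_of_flip_two hP hPc ho) (ε 0) (ε 1) (ε 2)

/-- Since the signed determinants agree in sign, the sum of the absolute values is the absolute
value of the signed sum. -/
theorem sum_abs_det3 (h : IsOctahedralSurface P x) (hP : Convex ℝ P)
    (hPc : IsClosed P) {o : E3} (ho : o ∈ interior P) :
    ∑ ε : Fin 3 → Bool, |det3 (x 0 (ε 0) - o) (x 1 (ε 1) - o) (x 2 (ε 2) - o)| =
      |det3 (diagonalVector x 0) (diagonalVector x 1) (diagonalVector x 2)| := by
  rw [← sum_signProd_mul_det3 x o]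
  have hs := h.signProd_mul_det3_same_sign hP hPc ho
  set g : (Fin 3 → Bool) → ℝ :=
    fun ε => signProd ε * det3 (x 0 (ε 0) - o) (x 1 (ε 1) - o) (x 2 (ε 2) - o) with hg
  have habs : ∀ ε, |det3 (x 0 (ε 0) - o) (x 1 (ε 1) - o) (x 2 (ε 2) - o)| = |g ε| := fun ε => by
    rw [hg, abs_mul, abs_signProd, one_mul]
  simp_rw [habs]
  rcases lt_trichotomy (det3 (x 0 true - o) (x 1 true - o) (x 2 true - o)) 0 with h0 | h0 | h0
  · have hneg : ∀ ε, g ε < 0 := fun ε => neg_of_mul_pos_left (hs ε) h0.le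
    rw [abs_of_nonpos (Finset.sum_nonpos fun ε _ => (hneg ε).le), ← Finset.sum_neg_distrib]
    exact Finset.sum_congr rfl fun ε _ => abs_of_neg (hneg ε)
  · exact absurd (hs fun _ => true) (by rw [h0]; simp)
  · have hpos : ∀ ε, 0 < g ε := fun ε => pos_of_mul_pos_left (hs ε) h0.le
    rw [abs_of_nonneg (Finset.sum_nonneg fun ε _ => (hpos ε).le)]
    exact Finset.sum_congr rfl fun ε _ => abs_of_pos (hpos ε)

theorem vol_le (h : IsOctahedralSurface P x) (hP : Convex ℝ P) (hPc : IsCompact P)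
    (hne : (interior P).Nonempty) :
    vol P ≤ |det3 (diagonalVector x 0) (diagonalVector x 1) (diagonalVector x 2)| / 6 := by
  obtain ⟨o, ho⟩ := hne
  have hcover : P ⊆ ⋃ ε, convexHull ℝ (range (Fin.cons o (corners x ε) : Fin 4 → E3)) := by
    have hmem : ∀ ε, o ∈ convexHull ℝ (range (Fin.cons o (corners x ε) : Fin 4 → E3)) := fun ε =>
      subset_convexHull ℝ _ ⟨0, rfl⟩
    intro p hp
    rcases eq_or_ne p o with rfl | hpo
    · exact mem_iUnion.2 ⟨fun _ => true, hmem _⟩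
    obtain ⟨t, ht, hq⟩ := exists_add_smul_mem_frontier hPc.isBounded hp (sub_ne_zero.2 hpo)
    rw [h.frontier_eq, mem_iUnion] at hq
    obtain ⟨ε, hq⟩ := hq
    refine mem_iUnion.2 ⟨ε, ?_⟩
    have hq' := convexHull_mono (𝕜 := ℝ)
      (show range (corners x ε) ⊆ range (Fin.cons o (corners x ε) : Fin 4 → E3) by
        rw [Fin.range_cons]; exact subset_insert _ _) hq
    have ht1 : (1 + t) ≠ 0 := by positivity
    -- `p` lies on the segment from `o` to the boundary point `p + t • (p - o)`.
    have : p = (t / (1 + t)) • o + (1 / (1 + t)) • (p + t • (p - o)) := by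
      have h1 : p = (1 / (1 + t)) • ((1 + t) • p) := by
        rw [smul_smul, one_div_mul_cancel ht1, one_smul]
      have h2 : (1 + t) • p = t • o + (p + t • (p - o)) := by module
      conv_lhs => rw [h1, h2]
      module
    rw [this]
    exact (convex_convexHull ℝ _) (hmem ε) hq' (by positivity) (by positivity) (by field_simp; ring)
  rw [vol, ← h.sum_abs_det3 hP hPc.isClosed ho, Finset.sum_div]
  refine ENNReal.toReal_le_of_le_ofReal (Finset.sum_nonneg fun _ _ => by positivity) ?_
  rw [ENNReal.ofReal_sum_of_nonneg fun _ _ => by positivity]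
  refine (measure_mono hcover).trans ((measure_iUnion_le _).trans_eq ?_)
  rw [tsum_fintype]
  exact Finset.sum_congr rfl fun ε _ => volume_tetrahedron o _

theorem eq_convexHull (h : IsOctahedralSurface P x) (hP : Convex ℝ P) (hPc : IsCompact P) :
    P = convexHull ℝ (⋃ i, range (x i)) := by
  have hfr : frontier P ⊆ convexHull ℝ (⋃ i, range (x i)) := by
    rw [h.frontier_eq]
    refine iUnion_subset fun ε => convexHull_mono ?_
    rintro _ ⟨i, rfl⟩
    exact mem_iUnion.2 ⟨i, mem_range_self _⟩
  refine Subset.antisymm (fun p hp => ?_) (convexHull_min (iUnion_subset fun i => ?_) hP)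
  -- A line through `p` meets the frontier on both sides of `p`.
  · obtain ⟨v, hv⟩ : ∃ v : E3, v ≠ 0 := exists_ne 0
    obtain ⟨s, hs, hps⟩ := exists_add_smul_mem_frontier hPc.isBounded hp hv
    obtain ⟨t, ht, hpt⟩ := exists_add_smul_mem_frontier hPc.isBounded hp (neg_ne_zero.2 hv)
    rcases hs.eq_or_lt with rfl | hs
    · simpa using hfr hps
    have hst : s + t ≠ 0 := by positivity
    have : p = (t / (s + t)) • (p + s • v) + (s / (s + t)) • (p + t • -v) := by
      have h1 : p = (t / (s + t) + s / (s + t)) • p := by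
        rw [← add_div, add_comm, div_self hst, one_smul]
      conv_lhs => rw [h1]
      module
    rw [this]
    exact (convex_convexHull ℝ _) (hfr hps) (hfr hpt) (by positivity) (by positivity)
      (by field_simp; ring)
  · rintro _ ⟨b, rfl⟩
    exact hPc.isClosed.frontier_subset (h.convexHull_subset_frontier (fun _ => b)
      (subset_convexHull ℝ _ ⟨i, rfl⟩))

end IsOctahedralSurface

/-! ### The regular octahedron -/

section RegularOctahedron

variable (c : E3) (r : ℝ) (u : OrthonormalBasis (Fin 3) ℝ E3)

/-- The vertices of the regular octahedron with center `c`, half-diagonal `r` and axes `u`. -/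
noncomputable def regularVertices (i : Fin 3) (b : Bool) : E3 := c + (sgn b * r) • u i

theorem iUnion_range_regularVertices :
    ⋃ i, range (regularVertices c r u i) =
      range (fun i => c + r • u i) ∪ range (fun i => c - r • u i) := by
  ext v
  simp only [mem_iUnion, mem_range, mem_union, regularVertices]
  constructor
  · rintro ⟨i, b, rfl⟩
    cases b
    · exact Or.inr ⟨i, by simp [sub_eq_add_neg]⟩
    · exact Or.inl ⟨i, by simp⟩
  · rintro (⟨i, rfl⟩ | ⟨i, rfl⟩)
    · exact ⟨i, true, by simp⟩
    · exact ⟨i, false, by simp [sub_eq_add_neg]⟩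

theorem norm_areaVector_regularVertices (ε : Fin 3 → Bool) :
    ‖areaVector (corners (regularVertices c r u) ε)‖ = √3 / 2 * r ^ 2 := by
  have hinner : ∀ i j k l : Fin 3,
      ⟪corners (regularVertices c r u) ε i - corners (regularVertices c r u) ε j,
        corners (regularVertices c r u) ε k - corners (regularVertices c r u) ε l⟫_ℝ =
      r ^ 2 * (sgn (ε i) * sgn (ε k) * ⟪u i, u k⟫_ℝ - sgn (ε i) * sgn (ε l) * ⟪u i, u l⟫_ℝ -
        sgn (ε j) * sgn (ε k) * ⟪u j, u k⟫_ℝ + sgn (ε j) * sgn (ε l) * ⟪u j, u l⟫_ℝ) := by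
    intro i j k l
    simp only [corners, regularVertices, add_sub_add_left_eq_sub, inner_sub_left, inner_sub_right,
      real_inner_smul_left, real_inner_smul_right]
    ring
  have hc : ‖cross (corners (regularVertices c r u) ε 1 - corners (regularVertices c r u) ε 0)
      (corners (regularVertices c r u) ε 2 - corners (regularVertices c r u) ε 0)‖ =
      √3 * r ^ 2 := by
    rw [← sq_eq_sq₀ (norm_nonneg _) (by positivity), ← real_inner_self_eq_norm_sq,
      inner_cross_cross, mul_pow, Real.sq_sqrt (by norm_num)]
    simp only [hinner, u.inner_eq_ite]
    simp [sgn_mul_self]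
    ring
  rw [areaVector, norm_smul, hc]
  norm_num
  ring

/-- The taxicab distance from `c` with respect to the axes `u`. -/
noncomputable def taxicabDist (y : E3) : ℝ := ∑ i, |⟪u i, y - c⟫_ℝ|

theorem continuous_taxicabDist : Continuous (taxicabDist c u) := by
  unfold taxicabDist; fun_prop

variable {c r u}

theorem convex_taxicabDist_le : Convex ℝ {y | taxicabDist c u y ≤ r} := by
  intro y hy z hz s t hs ht hst
  simp only [mem_ofPred_eq, taxicabDist] at hy hz ⊢
  calc ∑ i, |⟪u i, s • y + t • z - c⟫_ℝ|
      ≤ ∑ i, (s * |⟪u i, y - c⟫_ℝ| + t * |⟪u i, z - c⟫_ℝ|) := by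
        refine Finset.sum_le_sum fun i _ => ?_
        have : s • y + t • z - c = s • (y - c) + t • (z - c) := by
          rw [show s • (y - c) + t • (z - c) = s • y + t • z - (s + t) • c by module, hst,
            one_smul]
        rw [this, inner_add_right, real_inner_smul_right, real_inner_smul_right]
        refine (abs_add_le _ _).trans_eq ?_
        rw [abs_mul, abs_mul, abs_of_nonneg hs, abs_of_nonneg ht]
    _ = s * ∑ i, |⟪u i, y - c⟫_ℝ| + t * ∑ i, |⟪u i, z - c⟫_ℝ| := by
        rw [Finset.sum_add_distrib, Finset.mul_sum, Finset.mul_sum]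
    _ ≤ s * r + t * r := by gcongr
    _ = r := by rw [← add_mul, hst, one_mul]

/-- The signs of the coordinates of `y` select the face, and their absolute values, divided by
`r`, are the barycentric coordinates. -/
theorem exists_mem_face_of_taxicabDist_eq (hr : 0 < r) {y : E3} (hy : taxicabDist c u y = r) :
    ∃ ε, y ∈ convexHull ℝ (range (corners (regularVertices c r u) ε)) := by
  refine ⟨fun i => decide (0 ≤ ⟪u i, y - c⟫_ℝ), mem_convexHull_range_iff.2
    ⟨fun i => |⟪u i, y - c⟫_ℝ| / r, fun i => by positivity, ?_, ?_⟩⟩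
  · rw [← Finset.sum_div, ← hy, taxicabDist, div_self]
    rw [taxicabDist] at hy; rw [hy]; exact hr.ne'
  · have hterm : ∀ i, (|⟪u i, y - c⟫_ℝ| / r) •
        corners (regularVertices c r u) (fun i => decide (0 ≤ ⟪u i, y - c⟫_ℝ)) i =
        (|⟪u i, y - c⟫_ℝ| / r) • c + ⟪u i, y - c⟫_ℝ • u i := by
      intro i
      have hs : |⟪u i, y - c⟫_ℝ| / r * (sgn (decide (0 ≤ ⟪u i, y - c⟫_ℝ)) * r) =
          ⟪u i, y - c⟫_ℝ := by
        by_cases h : 0 ≤ ⟪u i, y - c⟫_ℝ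
        · simp only [h, decide_true, sgn_true, abs_of_nonneg]; field_simp
        · simp only [h, decide_false, sgn_false, abs_of_neg (not_le.1 h)]; field_simp
      rw [corners, regularVertices, smul_add, smul_smul, hs]
    rw [Finset.sum_congr rfl fun i _ => hterm i, Finset.sum_add_distrib, u.sum_repr',
      ← Finset.sum_smul, ← Finset.sum_div]
    rw [taxicabDist] at hy
    rw [hy, div_self hr.ne', one_smul]
    abel

/-- The regular octahedron is a ball of the taxicab distance. -/
theorem convexHull_regularVertices (hr : 0 < r) :
    convexHull ℝ (⋃ i, range (regularVertices c r u i)) = {y | taxicabDist c u y ≤ r} := by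
  refine Subset.antisymm (convexHull_min (iUnion_subset fun i => ?_) convex_taxicabDist_le) ?_
  · rintro _ ⟨b, rfl⟩
    simp [taxicabDist, regularVertices, real_inner_smul_right, u.inner_eq_ite, apply_ite abs,
      abs_mul, abs_sgn, abs_of_pos hr]
  · have hface : ∀ y, taxicabDist c u y = r →
        y ∈ convexHull ℝ (⋃ i, range (regularVertices c r u i)) := fun y hy => by
      obtain ⟨ε, hε⟩ := exists_mem_face_of_taxicabDist_eq hr hy
      refine convexHull_mono ?_ hε
      rintro _ ⟨i, rfl⟩
      exact mem_iUnion.2 ⟨i, mem_range_self _⟩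
    have hc : c ∈ convexHull ℝ (⋃ i, range (regularVertices c r u i)) := by
      have h := (convex_convexHull ℝ (⋃ i, range (regularVertices c r u i)))
        (subset_convexHull ℝ _ (mem_iUnion.2 ⟨0, mem_range_self true⟩))
        (subset_convexHull ℝ _ (mem_iUnion.2 ⟨0, mem_range_self false⟩))
        (show (0 : ℝ) ≤ 1 / 2 by norm_num) (show (0 : ℝ) ≤ 1 / 2 by norm_num) (by norm_num)
      convert h using 1
      simp only [regularVertices, sgn_true, sgn_false]
      module
    intro y (hy : taxicabDist c u y ≤ r)
    have hm0 : 0 ≤ taxicabDist c u y := Finset.sum_nonneg fun _ _ => abs_nonneg _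
    set m := taxicabDist c u y with hm
    rcases hm0.eq_or_lt with h0 | h0
    · have : y - c = 0 := by
        rw [← u.sum_repr' (y - c)]
        refine Finset.sum_eq_zero fun i hi => ?_
        have := (Finset.sum_eq_zero_iff_of_nonneg fun i _ => abs_nonneg ⟪u i, y - c⟫_ℝ).1
          (hm.symm.trans h0.symm) i hi
        rw [abs_eq_zero.1 this, zero_smul]
      rwa [sub_eq_zero.1 this]
    · have hy' : taxicabDist c u (c + (r / m) • (y - c)) = r := by
        simp only [taxicabDist, add_sub_cancel_left, real_inner_smul_right, abs_mul]
        rw [← Finset.mul_sum, abs_of_pos (by positivity)]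
        change r / m * m = r
        field_simp
      have h := (convex_convexHull ℝ (⋃ i, range (regularVertices c r u i))) hc (hface _ hy')
        (show 0 ≤ 1 - m / r by rw [sub_nonneg, div_le_one hr]; exact hy)
        (show 0 ≤ m / r by positivity) (by ring)
      convert h using 1
      rw [smul_add, smul_smul, div_mul_div_cancel₀ hr.ne', div_self h0.ne']
      module

theorem surfaceArea_regularOctahedron_le (hr : 0 < r) :
    surfaceArea (convexHull ℝ (⋃ i, range (regularVertices c r u i))) ≤ 4 * √3 * r ^ 2 := by
  have hcont := continuous_taxicabDist c u
  have hfr : frontier {y | taxicabDist c u y ≤ r} ⊆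
      ⋃ ε, convexHull ℝ (range (corners (regularVertices c r u) ε)) := fun y hy =>
    mem_iUnion.2 (exists_mem_face_of_taxicabDist_eq hr
      (frontier_le_subset_eq hcont continuous_const hy))
  rw [convexHull_regularVertices hr, surfaceArea]
  have hsum : ∑ ε : Fin 3 → Bool, ENNReal.ofReal
      ‖areaVector (corners (regularVertices c r u) ε)‖ = ENNReal.ofReal (4 * √3 * r ^ 2) := by
    rw [← ENNReal.ofReal_sum_of_nonneg fun _ _ => norm_nonneg _]
    simp only [norm_areaVector_regularVertices, Finset.sum_const, Finset.card_univ,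
      Fintype.card_pi, Fintype.card_bool, Finset.prod_const, Fintype.card_fin]
    congr 1
    norm_num
    ring
  refine ENNReal.toReal_le_of_le_ofReal (by positivity) ?_
  refine (measure_mono hfr).trans ((measure_iUnion_le _).trans_eq ?_)
  rw [tsum_fintype, ← hsum]
  exact Finset.sum_congr rfl fun ε _ => euclideanHausdorffMeasure_triangle _

theorem vol_regularOctahedron (hr : 0 < r) :
    vol (convexHull ℝ (⋃ i, range (regularVertices c r u i))) = 4 / 3 * r ^ 3 := by
  have hmp : MeasurePreserving (fun y : E3 => WithLp.ofLp (u.repr (y - c))) :=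
    (PiLp.volume_preserving_ofLp (Fin 3)).comp
      (u.repr.measurePreserving.comp (measurePreserving_sub_right volume c))
  have hvol := volume_sum_rpow_le (Fin 3) (p := 1) le_rfl r
  simp only [Real.rpow_one, div_one] at hvol
  have hmeas : MeasurableSet {w : Fin 3 → ℝ | ∑ i, |w i| ≤ r} :=
    (isClosed_le (by fun_prop) continuous_const).measurableSet
  have hset : {y | taxicabDist c u y ≤ r} =
      (fun y : E3 => WithLp.ofLp (u.repr (y - c))) ⁻¹' {w | ∑ i, |w i| ≤ r} := by
    ext y
    simp [taxicabDist, u.repr_apply_apply, inner_sub_right]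
  rw [convexHull_regularVertices hr, vol, hset, hmp.measure_preimage hmeas.nullMeasurableSet, hvol]
  have h2 : Real.Gamma (1 + 1) = 1 := by
    rw [Real.Gamma_add_one one_ne_zero, Real.Gamma_one, one_mul]
  have h4 : Real.Gamma ((Fintype.card (Fin 3) : ℝ) + 1) = 6 := by
    rw [Real.Gamma_nat_eq_factorial]; norm_num [Nat.factorial]
  rw [h2, h4, ENNReal.toReal_mul, ENNReal.toReal_pow, ENNReal.toReal_ofReal hr.le,
    ENNReal.toReal_ofReal (by positivity)]
  norm_num
  ring

end RegularOctahedron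

theorem isRegularOctahedron_of_eq {P : Set E3} {c : E3} {r : ℝ}
    {u : OrthonormalBasis (Fin 3) ℝ E3} (hr : r ≠ 0)
    (hP : P = convexHull ℝ (⋃ i, range (regularVertices c r u i))) : IsRegularOctahedron P := by
  rw [iUnion_range_regularVertices] at hP
  rcases hr.lt_or_gt with h | h
  · exact ⟨c, -r, u, neg_pos.2 h, by rw [hP, union_comm]; simp [sub_eq_add_neg]⟩
  · exact ⟨c, r, u, h, hP⟩

theorem IsRegularOctahedron.surfaceArea_pow_le {P : Set E3} (h : IsRegularOctahedron P) :
    surfaceArea P ^ 3 ≤ 108 * √3 * vol P ^ 2 := by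
  obtain ⟨c, r, u, hr, hP⟩ := h
  rw [← iUnion_range_regularVertices] at hP
  rw [hP, vol_regularOctahedron hr]
  refine (pow_le_pow_left₀ ENNReal.toReal_nonneg (surfaceArea_regularOctahedron_le hr)
    3).trans_eq ?_
  have h3 : √3 ^ 2 = 3 := Real.sq_sqrt (by norm_num)
  linear_combination 64 * √3 * r ^ 6 * h3

theorem mainTheorem3 (P : Set E3) (hP : IsThreePolytope P)
    (K : Geometry.SimplicialComplex ℝ E3) (hK : IsSurfaceTriangulation K P)
    (hoct : SameCombinatorialType K.toPreAbstractSimplicialComplex octahedronComplex) :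
    108 * Real.sqrt 3 ≤ surfaceArea P ^ 3 / vol P ^ 2 ∧
      (surfaceArea P ^ 3 / vol P ^ 2 = 108 * Real.sqrt 3 ↔ IsRegularOctahedron P) := by
  obtain ⟨⟨X, hX⟩, hne⟩ := hP
  obtain ⟨x, hx⟩ := exists_isOctahedralSurface hK.2 hoct
  have hconv : Convex ℝ P := hX ▸ convex_convexHull ℝ _
  have hcomp : IsCompact P := hX ▸ X.finite_toSet.isCompact_convexHull (𝕜 := ℝ)
  have hVpos : 0 < vol P := ENNReal.toReal_pos
    ((isOpen_interior.measure_pos volume hne).trans_le (measure_mono interior_subset)).ne'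
    hcomp.measure_lt_top.ne
  have hVD := hx.vol_le hconv hcomp hne
  set D := det3 (diagonalVector x 0) (diagonalVector x 1) (diagonalVector x 2) with hD
  have hD0 : D ≠ 0 := fun h => by rw [h] at hVD; simp at hVD; linarith
  have hVsq : 36 * vol P ^ 2 ≤ D ^ 2 := by
    rw [← sq_abs D]; nlinarith
  have hS := det3_sq_le_sum_norm_areaVector x
  rw [← hx.surfaceArea_eq, ← hD] at hS
  have h3 : √3 ^ 2 = 3 := Real.sq_sqrt (by norm_num)
  have h3pos : 0 < √3 := by positivity
  have hcube : (√3 * surfaceArea P) ^ 3 = 3 * √3 * surfaceArea P ^ 3 := by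
    linear_combination √3 * surfaceArea P ^ 3 * h3
  have hmain : 108 * √3 * vol P ^ 2 ≤ surfaceArea P ^ 3 := by
    have h1 : 27 * (36 * vol P ^ 2) ≤ 3 * √3 * surfaceArea P ^ 3 := by
      rw [← hcube]; linarith
    refine le_of_mul_le_mul_left ?_ (by positivity : 0 < 3 * √3)
    calc 3 * √3 * (108 * √3 * vol P ^ 2) = 27 * (36 * vol P ^ 2) := by
          linear_combination 324 * vol P ^ 2 * h3
      _ ≤ _ := h1
  have hV2 : 0 < vol P ^ 2 := by positivity
  refine ⟨(le_div_iff₀ hV2).2 hmain, fun heq => ?_, fun hreg => ?_⟩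
  · rw [div_eq_iff hV2.ne'] at heq
    have htight : (√3 * ∑ ε, ‖areaVector (corners x ε)‖) ^ 3 = 27 * D ^ 2 := by
      rw [← hx.surfaceArea_eq]
      refine le_antisymm ?_ hS
      rw [hcube, heq]
      calc 3 * √3 * (108 * √3 * vol P ^ 2) = 27 * (36 * vol P ^ 2) := by
            linear_combination 324 * vol P ^ 2 * h3
        _ ≤ _ := by linarith
    have hA : ∀ ε, areaVector (corners x ε) ≠ 0 := fun ε h0 => by
      obtain ⟨o, ho⟩ := hne
      have h1 := inner_areaVector_sub (corners x ε) o
      rw [h0, inner_zero_left, mul_zero] at h1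
      exact hx.det3_ne_zero hconv hcomp.isClosed ho ε h1.symm
    obtain ⟨c, r, u, hreg⟩ := exists_regular_of_sum_norm_areaVector_eq x hD0 hA htight
    have hxr : x = regularVertices c r u := funext fun i => funext fun b => hreg i b
    refine isRegularOctahedron_of_eq (fun hr => hD0 ?_) (hxr ▸ hx.eq_convexHull hconv hcomp)
    rw [hD, hxr]
    simp [hr, diagonalVector, regularVertices, det3_eq]
  · exact (div_eq_iff hV2.ne').2 (le_antisymm hreg.surfaceArea_pow_le hmain)
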